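/- Let $n\ge 2$. Let $\mathcal C$ be a set (of colors), let $\mathcal P$ be a property that subsets of $\mathbb R^n$ may or may not have, and let $\mathcal R\subseteq(0,\infty)$ be a set that is comeager near $0$, i.e. for some $\epsilon>0$ the set $\mathcal R\cap(0,\epsilon)$ is comeager in $(0,\epsilon)$. Write $S_r(p)$ for the sphere of radius $r$ centered at $p\in\mathbb R^n$ and $B_r(p)$ for the open ball; the spheres $S_r(p)$ with $p\in\mathbb R^n$ and $r\in\mathcal R$ are called admissible. "Countable" means finite or countably infinite. Suppose that $\mathcal P$ is a rigid geometric property: whenever $\Gamma\subseteq\mathbb R^n$ has property $\mathcal P$ and $a\in \mathrm{SE}(n)$ is a rigid motion (orientation-preserving isometry of $\mathbb R^n$), every set containing $a\cdot\Gamma$ has property $\mathcal P$. Let $f\colon\mathbb R^n\to\mathcal C$ be a coloring such that * for some color $c\in\mathcal C$ there is a nonempty open set $U\subseteq\mathbb R^n$ such that $f^{-1}(c)\cap U$ is comeager in $U$ (in the induced topology), and * for every color $c\in\mathcal C$ and every admissible sphere $S_r(p)$, if $f^{-1}(c)\cap S_r(p)$ has a subset with property $\mathcal P$, then $f(p)=c$.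 Then: 1. If every admissible sphere contains a countable subset that has property $\mathcal P$, then $f$ is constant on some nonempty open subset of $\mathbb R^n$. 2. If there is $\delta\in(0,1)$ such that for every admissible sphere $S_r(p)$ and every $x\in S_r(p)$ the open cap $B_{\delta r\sqrt2}(x)\cap S_r(p)$ contains a countable subset that has property $\mathcal P$, then $f$ is constant on $\mathbb R^n$. -/

import Mathlib

namespace SphereForcing

/-- `A` is comeager in the subspace `U`: the trace of `A` on `U` is comeager (its complement is
meager) for the induced topology of `U`. -/
def ComeagerIn {X : Type*} [TopologicalSpace X] (A U : Set X) : Prop :=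
  ((↑) ⁻¹' A : Set U) ∈ residual U

/-- `A` is comeager in some nonempty open set. -/
def SomewhereComeager {X : Type*} [TopologicalSpace X] (A : Set X) : Prop :=
  ∃ U : Set X, IsOpen U ∧ U.Nonempty ∧ ComeagerIn A U

/-- A set of reals is comeager near `0` if it is comeager in `(0, ε)` for some `ε > 0`. -/
def ComeagerNearZero (R : Set ℝ) : Prop :=
  ∃ ε : ℝ, 0 < ε ∧ ComeagerIn R (Set.Ioo 0 ε)

/-- Some color class is somewhere comeager. -/
def SomewhereComeagerColoring {X C : Type*} [TopologicalSpace X] (f : X → C) : Prop :=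
  ∃ c : C, SomewhereComeager (f ⁻¹' {c})

/-- `f` is constant. -/
def Monochromatic {X C : Type*} (f : X → C) : Prop :=
  ∀ x y, f x = f y

/-- `f` is constant on some nonempty open set. -/
def SomewhereLocallyMonochromatic {X C : Type*} [TopologicalSpace X] (f : X → C) : Prop :=
  ∃ U : Set X, IsOpen U ∧ U.Nonempty ∧ ∀ x ∈ U, ∀ y ∈ U, f x = f y

/-- The forcing condition for the property `P`, the set `M` of admissible centers and the set `R`
of admissible radii: if a color class contains, on an admissible sphere, a set with property `P`,
then the center of the sphere has that color. -/
def ForcingCondition {n : ℕ} {C : Type*} (P : Set (EuclideanSpace ℝ (Fin n)) → Prop)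
    (M : Set (EuclideanSpace ℝ (Fin n))) (R : Set ℝ)
    (f : EuclideanSpace ℝ (Fin n) → C) : Prop :=
  ∀ c : C, ∀ p ∈ M, ∀ r ∈ R,
    (∃ Γ : Set (EuclideanSpace ℝ (Fin n)), Γ ⊆ f ⁻¹' {c} ∩ Metric.sphere p r ∧ P Γ) → f p = c

/-- `f` is a somewhere comeager coloring that satisfies the forcing condition for `P` with all
points as admissible centers and with a set `R` of admissible (positive) radii that is comeager
near `0`. -/
structure StarCondition {n : ℕ} {C : Type*} (P : Set (EuclideanSpace ℝ (Fin n)) → Prop)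
    (R : Set ℝ) (f : EuclideanSpace ℝ (Fin n) → C) : Prop where
  somewhereComeager : SomewhereComeagerColoring f
  radii_pos : R ⊆ Set.Ioi 0
  radii_comeager : ComeagerNearZero R
  forcing : ForcingCondition P Set.univ R f

/-- The rigid motions of `ℝⁿ`, that is, the elements of `SE(n)`: a rotation in `SO(n)` followed by
a translation. -/
def IsRigidMotion {n : ℕ} (a : EuclideanSpace ℝ (Fin n) → EuclideanSpace ℝ (Fin n)) : Prop :=
  ∃ A ∈ Matrix.specialOrthogonalGroup (Fin n) ℝ, ∃ v : EuclideanSpace ℝ (Fin n),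
    ∀ x, a x = Matrix.toEuclideanLin A x + v

/-- If `Γ` has property `P` and `a` is a rigid motion, then every set that contains `a • Γ` has
property `P`. -/
def RigidGeometricProperty {n : ℕ} (P : Set (EuclideanSpace ℝ (Fin n)) → Prop) : Prop :=
  ∀ Γ : Set (EuclideanSpace ℝ (Fin n)), P Γ →
    ∀ a : EuclideanSpace ℝ (Fin n) → EuclideanSpace ℝ (Fin n), IsRigidMotion a →
      ∀ T : Set (EuclideanSpace ℝ (Fin n)), a '' Γ ⊆ T → P T

/-- There is `δ ∈ (0, 1)` such that on every sphere with radius `r` in `R` every open cap of radius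
`δ r √2` contains a countable (finite or infinite) subset with property `P`. -/
def CountableUniformCapProperty {n : ℕ} (P : Set (EuclideanSpace ℝ (Fin n)) → Prop)
    (R : Set ℝ) : Prop :=
  ∃ δ ∈ Set.Ioo (0 : ℝ) 1, ∀ p : EuclideanSpace ℝ (Fin n), ∀ r ∈ R, ∀ x ∈ Metric.sphere p r,
    ∃ Γ : Set (EuclideanSpace ℝ (Fin n)),
      Γ ⊆ Metric.ball x (δ * r * √2) ∩ Metric.sphere p r ∧ Γ.Countable ∧ P Γ

end SphereForcing

/-!
The proof has a Baire category part and an elementary geometric part.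

Let the color class `A` of `c` be comeager in the open set `U`, and let `p ∈ U`. Polar coordinates
`(r, g) ↦ p + r • g e`, with `g` in the rotation group `SO(n)`, form a continuous open map
(`nhds_polarPoint_le`), so for comeagerly many small `r` comeagerly many `g` satisfy
`p + r • g e ∈ A`, by the Kuratowski–Ulam theorem (`eventually_residual_of_prod`). Fix such an `r`
which is also an admissible radius. A countable set `Γ` with property `P` on the sphere of radius
`r` about `p` puts countably many comeager conditions on `g`, and `SO(n)` is a Baire space, so some
rotation about `p` carries `Γ` into `A` (`exists_rigidMotion_image_subset`). The forcing condition
then gives `f p = c`. Hence `f` equals `c` on all of `U`, which is the first claim.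

For the second claim, `A` contains a ball about some `q`. For a small admissible radius `r`, each
sphere of radius `r` whose centre is on the boundary of a ball about `q`, or a little outside it,
has a cap of radius `δ * r * √2` inside the ball; this uses `δ < 1`. The forcing condition therefore
enlarges the monochromatic ball, increasing the square of its radius by a fixed amount each time, and
the enlarged balls exhaust the space (`SphereForcing.StarCondition.eq_of_ball_subset`).
-/

open Set Filter Topology Matrix

/-! ### The Kuratowski–Ulam theorem -/

/-- One half of the Kuratowski–Ulam theorem: almost all sections of a comeager subset of a product
are comeager. -/
theorem eventually_residual_of_prod {X Y : Type*} [TopologicalSpace X] [TopologicalSpace Y]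
    [SecondCountableTopology Y] {D : Set (X × Y)} (hD : D ∈ residual (X × Y)) :
    ∀ᶠ x in residual X, {y | (x, y) ∈ D} ∈ residual Y := by
  obtain ⟨S, hSo, hSd, hSc, hSD⟩ := mem_residual_iff.1 hD
  -- Density of a section is tested on the countably many basic open sets `V`; the points `x` whose
  -- section of `O` meets `V` form the dense open projection of `O ∩ univ ×ˢ V`.
  have key : ∀ O ∈ S, ∀ᶠ x in residual X, Dense {y | (x, y) ∈ O} := by
    intro O hO
    have hB := TopologicalSpace.isBasis_countableBasis Y
    have h1 : ∀ V ∈ TopologicalSpace.countableBasis Y,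
        ∀ᶠ x in residual X, ∃ y ∈ V, (x, y) ∈ O := by
      intro V hV
      have hVo := hB.isOpen hV
      have heq : {x : X | ∃ y ∈ V, (x, y) ∈ O} = Prod.fst '' (O ∩ univ ×ˢ V) := by
        ext x; simp [and_comm]
      apply residual_of_dense_open
      · rw [heq]
        exact isOpenMap_fst _ ((hSo O hO).inter (isOpen_univ.prod hVo))
      · rw [heq, dense_iff_inter_open]
        intro W hW hWn
        obtain ⟨z, hz, hzO⟩ := (hSd O hO).inter_open_nonempty (W ×ˢ V) (hW.prod hVo)
          (hWn.prod (TopologicalSpace.nonempty_of_mem_countableBasis hV))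
        exact ⟨z.1, hz.1, z, ⟨hzO, mem_univ _, hz.2⟩, rfl⟩
    filter_upwards [(eventually_countable_ball
      (TopologicalSpace.countable_countableBasis Y)).2 h1] with x hx
    rw [hB.dense_iff]
    exact fun V hV _ => hx V hV
  filter_upwards [(eventually_countable_ball hSc).2 key] with x hx
  refine mem_of_superset ((countable_bInter_mem hSc).2 fun O hO =>
    residual_of_dense_open ((hSo O hO).preimage (by fun_prop : Continuous fun y => (x, y)))
      (hx O hO)) ?_
  intro y hy
  exact hSD fun O hO => mem_iInter₂.1 hy O hO

/-! ### Householder matrices -/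

/-- The Householder matrix of `w`, that is, the matrix of the reflection in the hyperplane orthogonal
to `w`. For `w = 0` it is the identity. -/
noncomputable def householder {m : Type*} [Fintype m] [DecidableEq m] (w : m → ℝ) :
    Matrix m m ℝ :=
  1 - (2 / (w ⬝ᵥ w)) • vecMulVec w w

section
variable {m : Type*} [Fintype m] [DecidableEq m]

theorem householder_mulVec (w x : m → ℝ) :
    householder w *ᵥ x = x - (2 / (w ⬝ᵥ w) * (w ⬝ᵥ x)) • w := by
  simp [householder, sub_mulVec, smul_mulVec, vecMulVec_mulVec, smul_smul]

theorem transpose_householder (w : m → ℝ) : (householder w)ᵀ = householder w := by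
  simp [householder, transpose_vecMulVec]

theorem householder_mul_self {w : m → ℝ} (hw : w ≠ 0) : householder w * householder w = 1 := by
  have h : w ⬝ᵥ w ≠ 0 := by simpa using hw
  simp only [householder, sub_mul, mul_sub, one_mul, mul_one, smul_mul_smul_comm,
    vecMulVec_mul_vecMulVec, vecMulVec_smul, smul_smul]
  have : 2 / w ⬝ᵥ w * (2 / w ⬝ᵥ w) * w ⬝ᵥ w = 2 / w ⬝ᵥ w + 2 / w ⬝ᵥ w := by
    field_simp; norm_num
  rw [this, add_smul]; abel

theorem det_householder {w : m → ℝ} (hw : w ≠ 0) : (householder w).det = -1 := by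
  have h : w ⬝ᵥ w ≠ 0 := by simpa using hw
  have : householder w = 1 - replicateCol Unit ((2 / (w ⬝ᵥ w)) • w) * replicateRow Unit w := by
    rw [householder, ← smul_vecMulVec, vecMulVec_eq Unit]
  rw [this, det_one_sub_mul_comm]
  simp [replicateRow_mul_replicateCol_apply]
  field_simp; norm_num

theorem householder_mul_householder_mem {v w : m → ℝ} (hv : v ≠ 0) (hw : w ≠ 0) :
    householder v * householder w ∈ specialOrthogonalGroup m ℝ := by
  rw [mem_specialOrthogonalGroup_iff, mem_orthogonalGroup_iff]
  constructor
  · rw [transpose_mul,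
      transpose_householder, transpose_householder, mul_assoc, ← mul_assoc (householder w),
      householder_mul_self hw, one_mul, householder_mul_self hv]
  · simp [det_householder hv, det_householder hw]

/-- The reflection in `a` sends `a` to `-a`, and the one in `a + b` sends `-a` to `b`. -/
theorem householder_add_mul_mulVec {a b : m → ℝ} (ha : a ≠ 0) (hab : a + b ≠ 0)
    (h : a ⬝ᵥ a = b ⬝ᵥ b) : (householder (a + b) * householder a) *ᵥ a = b := by
  have h1 : a ⬝ᵥ a ≠ 0 := by simpa using ha
  have h2 : (a + b) ⬝ᵥ (a + b) ≠ 0 := by rwa [Ne, dotProduct_self_eq_zero]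
  have h3 : (a + b) ⬝ᵥ (a + b) = 2 * ((a + b) ⬝ᵥ a) := by
    simp only [add_dotProduct, dotProduct_add, ← h, dotProduct_comm b a]; ring
  have h4 : householder a *ᵥ a = -a := by
    rw [householder_mulVec, div_mul_cancel₀ _ h1, two_smul]; abel
  rw [← mulVec_mulVec, h4, mulVec_neg, householder_mulVec, div_mul_eq_mul_div, ← h3, div_self h2,
    one_smul]
  abel

theorem continuousAt_householder {w : m → ℝ} (hw : w ≠ 0) : ContinuousAt householder w := by
  have h : w ⬝ᵥ w ≠ 0 := by simpa using hw
  unfold householder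
  have h1 : Continuous fun w : m → ℝ => w ⬝ᵥ w := by fun_prop
  have h2 : Continuous fun w : m → ℝ => vecMulVec w w := by fun_prop
  exact continuousAt_const.sub
    ((continuousAt_const.div h1.continuousAt h).smul h2.continuousAt)

theorem householder_smul {t : ℝ} (ht : t ≠ 0) (w : m → ℝ) :
    householder (t • w) = householder w := by
  by_cases hw : w = 0
  · simp [hw]
  have h : w ⬝ᵥ w ≠ 0 := by simpa using hw
  simp only [householder, smul_dotProduct, dotProduct_smul, smul_eq_mul, smul_vecMulVec,
    vecMulVec_smul, smul_smul]
  congr 2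
  field_simp

end

/-! ### The rotation group -/

instance (n : ℕ) : BaireSpace (specialOrthogonalGroup (Fin n) ℝ) := by
  have hc : IsClosed (specialOrthogonalGroup (Fin n) ℝ : Set (Matrix (Fin n) (Fin n) ℝ)) := by
    have : (specialOrthogonalGroup (Fin n) ℝ : Set (Matrix (Fin n) (Fin n) ℝ)) =
        {A | A * Aᵀ = 1} ∩ {A | A.det = 1} := by
      ext A
      simp [mem_specialOrthogonalGroup_iff, mem_orthogonalGroup_iff]
    rw [this]
    exact (isClosed_eq (by fun_prop) (by fun_prop)).inter (isClosed_eq (by fun_prop) (by fun_prop))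
  have : LocallyCompactSpace (Matrix (Fin n) (Fin n) ℝ) :=
    inferInstanceAs (LocallyCompactSpace (Fin n → Fin n → ℝ))
  have : LocallyCompactSpace (specialOrthogonalGroup (Fin n) ℝ) := hc.locallyCompactSpace
  infer_instance

instance (n : ℕ) : SecondCountableTopology (specialOrthogonalGroup (Fin n) ℝ) := by
  have : SecondCountableTopology (Matrix (Fin n) (Fin n) ℝ) :=
    inferInstanceAs (SecondCountableTopology (Fin n → Fin n → ℝ))
  exact TopologicalSpace.Subtype.secondCountableTopology _

/-- The orbit map `g ↦ g a` of the rotation group onto the sphere through `a` is open at `1`: vectors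
near `a` of the same length are images of `a` under rotations near `1`. -/
theorem eventually_exists_rotation {m : Type*} [Fintype m] [DecidableEq m] {a : m → ℝ}
    (ha : a ≠ 0) {t : Set (specialOrthogonalGroup m ℝ)} (ht : t ∈ 𝓝 1) :
    ∀ᶠ b in 𝓝 a, a ⬝ᵥ a = b ⬝ᵥ b → ∃ g ∈ t, (g : Matrix m m ℝ) *ᵥ a = b := by
  obtain ⟨u, hu, hut⟩ := mem_nhds_subtype _ _ _ |>.1 ht
  have h2 : a + a ≠ 0 := by rw [← two_smul ℝ]; simpa using ha
  -- `b ↦ householder (a + b) * householder a` is a local section of the orbit map through `1`.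
  have hT : Tendsto (fun b => householder (a + b) * householder a) (𝓝 a) (𝓝 1) := by
    have h0 : householder (a + a) * householder a = 1 := by
      rw [← two_smul ℝ, householder_smul two_ne_zero, householder_mul_self ha]
    have h1 : ContinuousAt (fun b => householder (a + b)) a :=
      ContinuousAt.comp (f := fun b => a + b) (continuousAt_householder h2) (by fun_prop)
    have h3 := h1.mul (continuousAt_const (y := householder a))
    rw [ContinuousAt, Pi.mul_apply, h0] at h3
    exact h3
  have hne : ∀ᶠ b in 𝓝 a, a + b ≠ 0 :=
    (by fun_prop : Continuous fun b => a + b).continuousAt.eventually_ne h2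
  filter_upwards [hT hu, hne] with b hb hab h
  exact ⟨⟨_, householder_mul_householder_mem hab ha⟩, hut hb, householder_add_mul_mulVec ha hab h⟩

/-- A rotation carries `a` or `-a` to any given vector of the same length. Allowing `-a` spares the
case `b = -a`, where no product of reflections in the vectors `a` and `a + b` is available. -/
theorem exists_rotation_or_eq_neg {m : Type*} [Fintype m] [DecidableEq m] {a b : m → ℝ}
    (ha : a ≠ 0) (h : a ⬝ᵥ a = b ⬝ᵥ b) :
    ∃ g : specialOrthogonalGroup m ℝ, (g : Matrix m m ℝ) *ᵥ a = b ∨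
      (g : Matrix m m ℝ) *ᵥ (-a) = b := by
  by_cases hab : a + b = 0
  · exact ⟨1, Or.inr (by simpa using neg_eq_of_add_eq_zero_right hab)⟩
  · exact ⟨⟨_, householder_mul_householder_mem hab ha⟩,
      Or.inl (householder_add_mul_mulVec ha hab h)⟩

/-! ### Rotated spheres and comeager sets -/

section
variable {n : ℕ}
local notation "E" => EuclideanSpace ℝ (Fin n)
local notation "SO" => specialOrthogonalGroup (Fin n) ℝ

theorem dotProduct_self_eq_norm_sq (x : E) : x.ofLp ⬝ᵥ x.ofLp = ‖x‖ ^ 2 := by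
  simp [EuclideanSpace.real_norm_sq_eq, dotProduct, ← sq]

theorem norm_toEuclideanLin_rotation (g : SO) (x : E) :
    ‖toEuclideanLin (g : Matrix (Fin n) (Fin n) ℝ) x‖ = ‖x‖ := by
  have h := (mem_orthogonalGroup_iff' _ _).1 (mem_specialOrthogonalGroup_iff.1 g.2).1
  rw [← sq_eq_sq₀ (norm_nonneg _) (norm_nonneg _), ← dotProduct_self_eq_norm_sq,
    ← dotProduct_self_eq_norm_sq]
  simp only [toLpLin_apply]
  rw [dotProduct_mulVec, vecMul_mulVec, h, vecMul_one]

/-- The image of `(r, g)` under polar coordinates centred at `p`: the vector `e` is rotated by `g`,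
scaled by `r` and attached to `p`. A point of the sphere has many preimages `g`. -/
noncomputable def polarPoint (p e : E) (x : ℝ × SO) : E :=
  p + x.1 • toEuclideanLin (x.2 : Matrix (Fin n) (Fin n) ℝ) e

theorem continuous_polarPoint (p e : E) : Continuous (polarPoint p e) := by
  unfold polarPoint
  simp only [toLpLin_apply]
  have : Continuous fun x : ℝ × SO => (x.2 : Matrix (Fin n) (Fin n) ℝ) *ᵥ e.ofLp := by
    fun_prop
  have h2 := (PiLp.continuous_toLp 2 (fun _ : Fin n => ℝ)).comp this
  exact continuous_const.add (continuous_fst.smul h2)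

theorem dist_polarPoint {p e : E} (he : ‖e‖ = 1) {x : ℝ × SO} (hx : 0 < x.1) :
    dist (polarPoint p e x) p = x.1 := by
  simp [polarPoint, norm_smul, norm_toEuclideanLin_rotation, he, abs_of_pos hx]

/-- The polar coordinate map is open at all points with positive radius. -/
theorem nhds_polarPoint_le {p e : E} (he : ‖e‖ = 1) {x : ℝ × SO} (hx : 0 < x.1) :
    𝓝 (polarPoint p e x) ≤ map (polarPoint p e) (𝓝 x) := by
  obtain ⟨r, g⟩ := x
  replace hx : 0 < r := hx
  intro s hs
  obtain ⟨s₁, hs₁, s₂, hs₂, hs⟩ := mem_nhds_prod_iff.1 (mem_map.1 hs)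
  set a : E := toEuclideanLin (g : Matrix (Fin n) (Fin n) ℝ) e with ha
  have hna : ‖a‖ = 1 := by rw [ha, norm_toEuclideanLin_rotation, he]
  have ha0 : a.ofLp ≠ 0 := by
    intro h
    have : a = 0 := by ext i; simp [h]
    simp [this] at hna
  have hva : polarPoint p e (r, g) = p + r • a := rfl
  have ht : {h : SO | h * g ∈ s₂} ∈ 𝓝 (1 : SO) := by
    have hc : Continuous fun h : SO => h * g := by fun_prop
    exact hc.continuousAt (by simpa using hs₂)
  have hN : Tendsto (fun v : E => ‖v - p‖) (𝓝 (p + r • a)) (𝓝 r) := by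
    have hc : Continuous fun v : E => ‖v - p‖ := by fun_prop
    convert hc.tendsto (p + r • a) using 2
    simp [norm_smul, hna, abs_of_pos hx]
  have hB : Tendsto (fun v : E => (‖v - p‖⁻¹ • (v - p)).ofLp) (𝓝 (p + r • a)) (𝓝 a.ofLp) := by
    refine ((PiLp.continuous_ofLp 2 (fun _ : Fin n => ℝ)).tendsto a).comp ?_
    have hc : Continuous fun v : E => v - p := by fun_prop
    convert (hN.inv₀ hx.ne').smul (hc.tendsto (p + r • a)) using 2
    simp [smul_smul, hx.ne']
  rw [hva]
  filter_upwards [hN hs₁, hB (eventually_exists_rotation ha0 ht), hN (lt_mem_nhds hx)]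
    with v hv₁ hv₂ hv₃
  replace hv₃ : 0 < ‖v - p‖ := hv₃
  obtain ⟨h, hh, hha⟩ := hv₂ (by
    rw [dotProduct_self_eq_norm_sq, dotProduct_self_eq_norm_sq, hna, norm_smul, norm_inv,
      norm_norm, inv_mul_cancel₀ hv₃.ne'])
  have hmem : (‖v - p‖, h * g) ∈ s₁ ×ˢ s₂ := ⟨hv₁, hh⟩
  have := hs hmem
  have h3 : toEuclideanLin ((h * g : SO) : Matrix (Fin n) (Fin n) ℝ) e = ‖v - p‖⁻¹ • (v - p) := by
    ext i
    refine Eq.trans ?_ (congrFun hha i)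
    simp [ha, toLpLin_apply]
  rw [mem_preimage, polarPoint, h3] at this
  rwa [smul_smul, mul_inv_cancel₀ hv₃.ne', one_smul, add_sub_cancel] at this

/-- If `A` is comeager in a neighbourhood of `p`, then for almost every small radius `r` almost every
rotation about `p` carries `p + r • e` into `A`: the polar coordinate map is continuous and open, so
it pulls `A` back to a comeager subset of the product, to which the Kuratowski–Ulam theorem
applies. -/
theorem eventually_radius_eventually_rotation {A U : Set E}
    (hA : SphereForcing.ComeagerIn A U) {p e : E} (he : ‖e‖ = 1) {ε : ℝ}
    (hU : Metric.ball p ε ⊆ U) :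
    ∀ᶠ r : Ioo 0 ε in residual (Ioo 0 ε), ∀ᶠ g in residual SO, polarPoint p e (r, g) ∈ A := by
  let i : Ioo 0 ε × SO → ℝ × SO := Prod.map (↑) id
  have hi : IsOpenEmbedding i := isOpen_Ioo.isOpenEmbedding_subtypeVal.prodMap .id
  have hmem : ∀ x, (polarPoint p e ∘ i) x ∈ U := fun x => hU (by
    rw [Metric.mem_ball, Function.comp, dist_polarPoint he x.1.2.1]
    exact x.1.2.2)
  have hopen : IsOpenMap (polarPoint p e ∘ i) := by
    rw [isOpenMap_iff_nhds_le]
    intro x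
    rw [← Filter.map_map, hi.map_nhds_eq]
    exact nhds_polarPoint_le he x.1.2.1
  have := tendsto_residual_of_isOpenMap
    (((continuous_polarPoint p e).comp hi.continuous).subtype_mk hmem) (hopen.subtype_mk hmem) hA
  exact eventually_residual_of_prod (mem_map.1 this)

/-- If almost all rotations about `p` carry each of `p + r • e` and `p - r • e` into `A`, then some
rotation about `p` carries a given countable subset of the sphere into `A`: each of its points
imposes a comeager condition on the rotation, and the rotation group is a Baire space. -/
theorem exists_rigidMotion_image_subset {p e : E} (he : ‖e‖ = 1) {r : ℝ} (hr : 0 < r) {A : Set E}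
    (h₁ : ∀ᶠ g in residual SO, polarPoint p e (r, g) ∈ A)
    (h₂ : ∀ᶠ g in residual SO, polarPoint p (-e) (r, g) ∈ A)
    {Γ : Set E} (hΓ : Γ ⊆ Metric.sphere p r) (hc : Γ.Countable) :
    ∃ a : E → E, SphereForcing.IsRigidMotion a ∧ a '' Γ ⊆ A ∩ Metric.sphere p r := by
  have key : ∀ x ∈ Γ, ∀ᶠ g : SO in residual SO,
      p + toEuclideanLin (g : Matrix (Fin n) (Fin n) ℝ) (x - p) ∈ A := by
    intro x hx
    have hxr : ‖x - p‖ = r := by simpa [dist_eq_norm] using hΓ hx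
    have he0 : e.ofLp ≠ 0 := by
      intro h
      have : e = 0 := by ext i; simp [h]
      simp [this] at he
    obtain ⟨h, hh⟩ := exists_rotation_or_eq_neg (a := e.ofLp) (b := (r⁻¹ • (x - p)).ofLp) he0 (by
      rw [dotProduct_self_eq_norm_sq, dotProduct_self_eq_norm_sq, he, norm_smul, hxr, norm_inv,
        Real.norm_of_nonneg hr.le, inv_mul_cancel₀ hr.ne'])
    -- Right multiplication by `h` moves the comeager set of rotations for `± e` to one for `x - p`.
    have hmul := tendsto_residual_of_isOpenMap (Homeomorph.mulRight h).continuous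
      (Homeomorph.mulRight h).isOpenMap
    have hpt : ∀ e' : E, (h : Matrix (Fin n) (Fin n) ℝ) *ᵥ e'.ofLp = (r⁻¹ • (x - p)).ofLp →
        ∀ g : SO, polarPoint p e' (r, g * h) =
          p + toEuclideanLin (g : Matrix (Fin n) (Fin n) ℝ) (x - p) := by
      intro e' he' g
      have : x - p = r • WithLp.toLp 2 ((h : Matrix (Fin n) (Fin n) ℝ) *ᵥ e'.ofLp) := by
        rw [he', WithLp.toLp_ofLp, smul_smul, mul_inv_cancel₀ hr.ne', one_smul]
      rw [this, map_smul]
      simp [polarPoint, toLpLin_apply]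
    rcases hh with hh | hh
    · filter_upwards [hmul.eventually h₁] with g hg
      rw [← hpt e hh g]
      exact hg
    · filter_upwards [hmul.eventually h₂] with g hg
      rw [← hpt (-e) hh g]
      exact hg
  obtain ⟨g, hg⟩ := (dense_of_mem_residual ((eventually_countable_ball hc).2 key)).nonempty
  refine ⟨fun x => toEuclideanLin (g : Matrix (Fin n) (Fin n) ℝ) x +
    (p - toEuclideanLin (g : Matrix (Fin n) (Fin n) ℝ) p), ⟨g, g.2, _, fun _ => rfl⟩, ?_⟩
  rintro _ ⟨x, hx, rfl⟩
  have h1 : toEuclideanLin (g : Matrix (Fin n) (Fin n) ℝ) x +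
      (p - toEuclideanLin (g : Matrix (Fin n) (Fin n) ℝ) p) =
      p + toEuclideanLin (g : Matrix (Fin n) (Fin n) ℝ) (x - p) := by
    rw [map_sub]; abel
  have hxr : ‖x - p‖ = r := by simpa [dist_eq_norm] using hΓ hx
  simp only [h1]
  exact ⟨hg x hx, by
    rw [mem_sphere_iff_norm, add_sub_cancel_left, norm_toEuclideanLin_rotation, hxr]⟩

end

/-! ### Consequences of the forcing condition -/

namespace SphereForcing
variable {n : ℕ} {C : Type*} {P : Set (EuclideanSpace ℝ (Fin n)) → Prop} {R : Set ℝ}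
  {f : EuclideanSpace ℝ (Fin n) → C}

/-- A colour class that is comeager in an open set `U` contains `U`. -/
theorem StarCondition.eq_of_comeagerIn (hf : StarCondition P R f) (hP : RigidGeometricProperty P)
    (hn : n ≠ 0) (hR : ∀ p : EuclideanSpace ℝ (Fin n), ∀ r ∈ R,
      ∃ Γ : Set (EuclideanSpace ℝ (Fin n)), Γ ⊆ Metric.sphere p r ∧ Γ.Countable ∧ P Γ)
    {c : C} {U : Set (EuclideanSpace ℝ (Fin n))} (hU : IsOpen U) (hc : ComeagerIn (f ⁻¹' {c}) U)
    {p : EuclideanSpace ℝ (Fin n)} (hp : p ∈ U) : f p = c := by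
  have : NeZero n := ⟨hn⟩
  obtain ⟨ε₁, hε₁, hball⟩ := Metric.isOpen_iff.1 hU p hp
  obtain ⟨ε₂, hε₂, hRc⟩ := hf.radii_comeager
  set ε := min ε₁ ε₂
  have hε : 0 < ε := lt_min hε₁ hε₂
  let e : EuclideanSpace ℝ (Fin n) := EuclideanSpace.single 0 1
  have he : ‖e‖ = 1 := by simp [e]
  have hball' : Metric.ball p ε ⊆ U := (Metric.ball_subset_ball (min_le_left _ _)).trans hball
  have h₁ := eventually_radius_eventually_rotation hc he hball'
  have h₂ := eventually_radius_eventually_rotation (e := -e) hc (by simpa using he) hball'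
  have hsub : Ioo 0 ε ⊆ Ioo 0 ε₂ := Ioo_subset_Ioo_right (min_le_right _ _)
  have h₃ : ∀ᶠ r : Ioo 0 ε in residual (Ioo 0 ε), (r : ℝ) ∈ R :=
    tendsto_residual_of_isOpenMap (continuous_inclusion hsub)
      ((isOpen_Ioo.isOpenMap_subtype_val).subtype_mk fun r => hsub r.2) hRc
  have : BaireSpace (Ioo 0 ε) := isOpen_Ioo.baireSpace
  have : Nonempty (Ioo 0 ε) := ⟨⟨ε / 2, by constructor <;> linarith⟩⟩
  obtain ⟨r, ⟨hr₁, hr₂⟩, hr₃⟩ := (dense_of_mem_residual ((h₁.and h₂).and h₃)).nonempty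
  obtain ⟨Γ, hΓ, hΓc, hPΓ⟩ := hR p r hr₃
  obtain ⟨a, ha, haΓ⟩ := exists_rigidMotion_image_subset he r.2.1 hr₁ hr₂ hΓ hΓc
  exact hf.forcing c p (mem_univ _) r hr₃ ⟨a '' Γ, haΓ, hP Γ hPΓ a ha _ subset_rfl⟩

theorem ComeagerNearZero.exists_lt (hR : ComeagerNearZero R) {η : ℝ} (hη : 0 < η) :
    ∃ r ∈ R, 0 < r ∧ r < η := by
  obtain ⟨ε, hε, hRc⟩ := hR
  have : BaireSpace (Ioo 0 ε) := isOpen_Ioo.baireSpace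
  obtain ⟨r, hr, hrR⟩ := (dense_of_mem_residual hRc).inter_open_nonempty
    {r : Ioo 0 ε | (r : ℝ) < η} (isOpen_lt (by fun_prop) (by fun_prop))
    ⟨⟨min ε η / 2, by
      have := lt_min hε hη
      constructor
      · linarith
      · linarith [min_le_left ε η]⟩, by
      have := lt_min hε hη
      simp only [mem_ofPred_eq]
      linarith [min_le_right ε η]⟩
  exact ⟨r, hrR, r.2.1, hr⟩

/-- The distance to `q` of a point in the cap of radius `δ * r * √2` about the point nearest to `q` of
the sphere of radius `r` about `p`. The chord `r * √2` cuts out a hemisphere, so for `δ < 1` the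
linear term in `r` pulls the cap towards `q`. -/
theorem dist_sq_lt_of_mem_cap {F : Type*} [NormedAddCommGroup F] [InnerProductSpace ℝ F]
    {p q y : F} {r δ : ℝ} (hr : 0 < r) (hpq : p ≠ q) (hy : dist y p = r)
    (hcap : dist y (p - (r / dist p q) • (p - q)) < δ * r * √2) :
    dist y q ^ 2 < dist p q ^ 2 - 2 * dist p q * (1 - δ ^ 2) * r + r ^ 2 := by
  have hd : 0 < ‖p - q‖ := norm_pos_iff.2 (sub_ne_zero.2 hpq)
  simp only [dist_eq_norm] at *
  have e1 : y - (p - (r / ‖p - q‖) • (p - q)) = (y - p) + (r / ‖p - q‖) • (p - q) := by abel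
  have e2 : y - q = (y - p) + (p - q) := by abel
  have h1 : ‖(y - p) + (r / ‖p - q‖) • (p - q)‖ ^ 2 < (δ * r * √2) ^ 2 := by
    rw [← e1]
    exact pow_lt_pow_left₀ hcap (norm_nonneg _) two_ne_zero
  rw [norm_add_sq_real, inner_smul_right, norm_smul, Real.norm_of_nonneg (by positivity),
    div_mul_cancel₀ _ hd.ne', mul_pow, Real.sq_sqrt (by norm_num), hy] at h1
  rw [e2, norm_add_sq_real, hy]
  have h2 : r / ‖p - q‖ * inner ℝ (y - p) (p - q) * ‖p - q‖ = r * inner ℝ (y - p) (p - q) := by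
    field_simp
  have h3 : r / ‖p - q‖ * inner ℝ (y - p) (p - q) < r * (δ ^ 2 * r - r) := by nlinarith
  have h4 := mul_lt_mul_of_pos_right h3 hd
  rw [h2] at h4
  have h5 : inner ℝ (y - p) (p - q) < (δ ^ 2 * r - r) * ‖p - q‖ := by
    by_contra! hcon
    nlinarith
  nlinarith

/-- Under the cap property a colour class that contains a ball is everything: the square of its
radius can be increased by a fixed amount again and again. -/
theorem StarCondition.eq_of_ball_subset (hf : StarCondition P R f)
    (hcap : CountableUniformCapProperty P R) {c : C} {q : EuclideanSpace ℝ (Fin n)} {s : ℝ}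
    (hs : 0 < s) (h : Metric.ball q s ⊆ f ⁻¹' {c}) :
    f ⁻¹' {c} = univ := by
  obtain ⟨δ, ⟨hδ0, hδ1⟩, hδ⟩ := hcap
  set κ := 1 - δ ^ 2 with hκ
  have hκ0 : 0 < κ := by nlinarith
  obtain ⟨r, hrR, hr0, hr⟩ := hf.radii_comeager.exists_lt (mul_pos hs hκ0)
  have hγ : 0 < r * s * κ := by positivity
  -- One radius `r` serves for all balls of radius `t ≥ s` about `q`: a sphere of radius `r` whose
  -- centre is slightly outside the ball has a whole cap inside it.
  have step : ∀ t, s ≤ t → Metric.ball q t ⊆ f ⁻¹' {c} →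
      ∀ p, dist p q ^ 2 ≤ t ^ 2 + r * s * κ → f p = c := by
    intro t hst ht p hp
    by_cases hpt : dist p q < t
    · exact ht hpt
    push Not at hpt
    have hd : 0 < dist p q := by linarith
    have hpq : p ≠ q := dist_pos.1 hd
    obtain ⟨Γ, hΓ, -, hPΓ⟩ := hδ p r hrR (p - (r / dist p q) • (p - q)) (by
      have : ‖p - q‖ ≠ 0 := by rw [← dist_eq_norm]; exact hd.ne'
      simp [dist_eq_norm, norm_smul, this, abs_of_pos hr0])
    refine hf.forcing c p (mem_univ _) r hrR ⟨Γ, fun y hy => ⟨ht ?_, (hΓ hy).2⟩, hPΓ⟩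
    have h1 := dist_sq_lt_of_mem_cap hr0 hpq (hΓ hy).2 (hΓ hy).1
    rw [← hκ] at h1
    have h2 : s * (κ * r) ≤ dist p q * (κ * r) :=
      mul_le_mul_of_nonneg_right (hst.trans hpt) (by positivity)
    rw [Metric.mem_ball]
    refine lt_of_pow_lt_pow_left₀ 2 (by linarith) ?_
    nlinarith
  have grow : ∀ k : ℕ, Metric.ball q √(s ^ 2 + k * (r * s * κ)) ⊆ f ⁻¹' {c} := by
    intro k
    induction k with
    | zero => simpa [Real.sqrt_sq hs.le] using h
    | succ k ih =>
      intro p hp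
      refine step _ (Real.le_sqrt_of_sq_le (by
        have : 0 ≤ (k : ℝ) * (r * s * κ) := by positivity
        linarith)) ih p ?_
      rw [Real.sq_sqrt (by positivity)]
      have := (Real.lt_sqrt dist_nonneg).1 (Metric.mem_ball.1 hp)
      push_cast at this
      linarith
  refine eq_univ_of_forall fun p => ?_
  obtain ⟨k, hk⟩ := exists_nat_gt (dist p q ^ 2 / (r * s * κ))
  rw [div_lt_iff₀ hγ] at hk
  exact grow k ((Real.lt_sqrt dist_nonneg).2 (by nlinarith))

theorem CountableUniformCapProperty.exists_subset_sphere (h : CountableUniformCapProperty P R)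
    (hn : n ≠ 0) (hR : R ⊆ Ioi 0) (p : EuclideanSpace ℝ (Fin n)) (r : ℝ) (hr : r ∈ R) :
    ∃ Γ : Set (EuclideanSpace ℝ (Fin n)), Γ ⊆ Metric.sphere p r ∧ Γ.Countable ∧ P Γ := by
  obtain ⟨δ, -, hδ⟩ := h
  have : NeZero n := ⟨hn⟩
  have hr0 : 0 < r := hR hr
  obtain ⟨Γ, hΓ, hc, hPΓ⟩ := hδ p r hr (p + EuclideanSpace.single 0 r)
    (by simp [abs_of_pos hr0])
  exact ⟨Γ, hΓ.trans inter_subset_right, hc, hPΓ⟩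

end SphereForcing

theorem theorem3 {n : ℕ} (hn : 2 ≤ n) {C : Type*}
    (P : Set (EuclideanSpace ℝ (Fin n)) → Prop) (R : Set ℝ)
    (f : EuclideanSpace ℝ (Fin n) → C)
    (hP : SphereForcing.RigidGeometricProperty P)
    (hf : SphereForcing.StarCondition P R f) :
    ((∀ p : EuclideanSpace ℝ (Fin n), ∀ r ∈ R, ∃ Γ : Set (EuclideanSpace ℝ (Fin n)),
        Γ ⊆ Metric.sphere p r ∧ Γ.Countable ∧ P Γ) →
      SphereForcing.SomewhereLocallyMonochromatic f) ∧
    (SphereForcing.CountableUniformCapProperty P R → SphereForcing.Monochromatic f) := by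
  have hn0 : n ≠ 0 := by omega
  obtain ⟨c, U, hU, hUne, hc⟩ := hf.somewhereComeager
  refine ⟨fun hR => ⟨U, hU, hUne, fun x hx y hy => ?_⟩, fun hcap => ?_⟩
  · rw [hf.eq_of_comeagerIn hP hn0 hR hU hc hx, hf.eq_of_comeagerIn hP hn0 hR hU hc hy]
  · obtain ⟨q, hq⟩ := hUne
    obtain ⟨s, hs, hball⟩ := Metric.isOpen_iff.1 hU q hq
    have huniv := hf.eq_of_ball_subset hcap hs fun p hp =>
      hf.eq_of_comeagerIn hP hn0 (hcap.exists_subset_sphere hn0 hf.radii_pos) hU hc (hball hp)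
    have hall : ∀ x, f x = c := fun x => huniv.symm.subset (mem_univ x)
    exact fun x y => (hall x).trans (hall y).symm
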